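/- Let $F$ be a number field, $v$ a finite place of $F$, $G_v\subset G_F=\mathrm{Gal}(\overline F/F)$ a decomposition group at $v$ with inertia subgroup $I_v$, and $q=\#(\mathcal{O}_F/v)$. Let $K$ be a number field and $\lambda$ a prime of $K$ over the rational prime $\ell$, with $v\nmid\ell$; write $K_\lambda$ for the completion, $k_\lambda$ for its residue field, $\overline{K}_\lambda$, $\bar k_\lambda$ for algebraic closures, and fix a reduction map from the integers of $\overline{K}_\lambda$ to $\bar k_\lambda$ extending that of $K_\lambda$. Let $\varepsilon$ be the $\ell$-adic cyclotomic character and $\bar\varepsilon$ its reduction. Let $\rho\colon G_F\to \mathrm{GL}_2(K_\lambda)$ be a continuous representation (for example the representation $\rho_{f,\lambda}$ attached to a Hilbert newform $f$ over $F$ with $K=K_f$), and let $\bar\rho\colon G_F\to\mathrm{GL}_2(k_\lambda)$ be a residual representation of $\rho$, i.e. a continuous representation with the same semisimplification as the reduction of a $G_F$-stable lattice (for example that reduction itself, or its semisimplification). Suppose that, over $\overline{K}_\lambda$, $$\rho|_{G_v}\cong\begin{pmatrix}\varepsilon\chi & *\\ 0&\chi\end{pmatrix}$$ is a nonsplit extension,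 for a character $\chi\colon G_v\to\overline{K}_\lambda^\times$ (the special case), and that $q^2\not\equiv 1 \bmod \lambda$. Then $\chi$ has values in the units of the ring of integers of $\overline{K}_\lambda$, and, with $\bar\chi$ its reduction, $$\bar\rho|_{G_v}\otimes\bar k_\lambda\cong\begin{pmatrix}\bar\varepsilon\bar\chi&\nu\\0&\bar\chi\end{pmatrix}$$ for some $\nu$. Moreover, in every such form, $\nu$ is ramified unless it is trivial: if the extension class in $H^1(G_v,\bar k_\lambda(1))$ given by $\nu\bar\chi^{-1}$ is nonzero, then its restriction to $I_v$ is nonzero. -/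

import Mathlib

open NumberField IsDedekindDomain
open scoped Pointwise

noncomputable section

namespace SpecialReduction

section Galois

variable (F : Type*) [Field F]

/-- The absolute Galois group `G_F`, with its Krull topology. -/
abbrev AbsGal : Type _ := AlgebraicClosure F ≃ₐ[F] AlgebraicClosure F

variable {F}

/-- The decomposition group in `G_F` of a prime `w` of the ring of all algebraic integers of the
algebraic closure of `F`. If `w` lies over the finite place `v` of `F`, this is a decomposition
group `G_v ⊆ G_F` at `v`. -/
abbrev decompositionGroup (w : Ideal (𝓞 (AlgebraicClosure F))) : Subgroup (AbsGal F) :=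
  MulAction.stabilizer (AbsGal F) w

/-- The inertia group: all `σ` in the decomposition group with `σ x ≡ x mod w` for every algebraic
integer `x`. -/
abbrev inertiaGroup (w : Ideal (𝓞 (AlgebraicClosure F))) : Subgroup (decompositionGroup w) :=
  w.toAddSubgroup.inertia (decompositionGroup w)

/-- The `ℓ`-adic cyclotomic character `ε` of `G_F`. -/
def cyclotomic (F : Type*) [Field F] (ℓ : ℕ) [Fact ℓ.Prime] : AbsGal F →* ℤ_[ℓ]ˣ :=
  (cyclotomicCharacter (AlgebraicClosure F) ℓ).comp
    (MulSemiringAction.toRingAut (AbsGal F) (AlgebraicClosure F))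

end Galois

section Coefficients

variable {K : Type*} [Field K] [NumberField K] (l : HeightOneSpectrum (𝓞 K))

/-- The completion of `K` at the prime `l`. -/
abbrev Compl : Type _ := l.adicCompletion K

/-- The ring of integers of the completion. -/
abbrev Integers : Type _ := l.adicCompletionIntegers K

/-- The residue field of the completion (canonically the residue field of `𝓞 K` at `l`). -/
abbrev Residue : Type _ := IsLocalRing.ResidueField (Integers l)

/-- An algebraic closure of the completion. -/
abbrev ComplBar : Type _ := AlgebraicClosure (Compl l)

/-- The ring of integers of the algebraic closure of the completion. -/
abbrev IntegersBar : Type _ := integralClosure (Integers l) (ComplBar l)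

/-- An algebraic closure of the residue field. -/
abbrev ResidueBar : Type _ := AlgebraicClosure (Residue l)

/-- `red` is a reduction map from the integers of the algebraic closure of the completion to the
algebraic closure of the residue field, extending the reduction map of the completion. -/
def IsReductionMap (red : IntegersBar l →+* ResidueBar l) : Prop :=
  ∀ x : Integers l, red (algebraMap (Integers l) (IntegersBar l) x) =
    algebraMap (Residue l) (ResidueBar l) (IsLocalRing.residue (Integers l) x)

variable {l}

/-- `ρ₀` is an integral model of `ρ`, that is, the matrix form of the action of `G` on a
`G`-stable lattice in the space of `ρ`. -/
def IsIntegralModel {G : Type*} [Group G] (ρ : G →* GL (Fin 2) (Compl l))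
    (ρ₀ : G →* GL (Fin 2) (Integers l)) : Prop :=
  ∃ Q : GL (Fin 2) (Compl l), ∀ g : G,
    Matrix.GeneralLinearGroup.map (algebraMap (Integers l) (Compl l)) (ρ₀ g) = Q * ρ g * Q⁻¹

/-- `ρbar` is a residual representation of `ρ`: it is continuous (the residue field being
discrete, this means that the kernel is open), and it has the same semisimplification as the
reduction of some stable lattice of `ρ`, that is, the same characteristic polynomials. The
reduction of any stable lattice is of this kind, and so is its semisimplification. -/
def IsResidual {G : Type*} [Group G] [TopologicalSpace G] (ρ : G →* GL (Fin 2) (Compl l))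
    (ρbar : G →* GL (Fin 2) (Residue l)) : Prop :=
  IsOpen (ρbar.ker : Set G) ∧
  ∃ ρ₀ : G →* GL (Fin 2) (Integers l), IsIntegralModel ρ ρ₀ ∧
    ∀ g : G, (ρbar g).val.charpoly =
      (Matrix.GeneralLinearGroup.map (IsLocalRing.residue (Integers l)) (ρ₀ g)).val.charpoly

end Coefficients

section Extensions

variable {H L : Type*} [Group H] [Field L]

/-- In a suitable basis, `σ` is given by the matrices with first row `α, ν` and second row
`0, β`. -/
def HasForm (σ : H →* GL (Fin 2) L) (α β : H →* Lˣ) (ν : H → L) : Prop :=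
  ∃ P : GL (Fin 2) L, ∀ g : H,
    (P * σ g * P⁻¹).val = !![(α g : L), ν g; 0, (β g : L)]

/-- The restriction to the subgroup `I` of the extension of `β` by `α` given by `ν` splits.
Equivalently, the restriction to `I` of the cocycle `ν β⁻¹` with values in `α β⁻¹` is a
coboundary. -/
def SplitsOn (I : Subgroup H) (α β : H →* Lˣ) (ν : H → L) : Prop :=
  ∃ t : L, ∀ g ∈ I, ν g = t * ((α g : L) - (β g : L))

end Extensions

end SpecialReduction

end

/-! The characters are read off from characteristic polynomials. Those of an integral model have
`εχ` and `χ` as roots, so `χ` is integral, and reduction gives `ρbar` on `G_v` the characteristic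
polynomials of `εbar χbar ⊕ χbar`.

A Frobenius `φ` has `εbar(φ) = q ≠ 1`, so it separates the two characters. In an eigenbasis of `φ`,
traces determine the diagonal entries and multiplicativity makes the representation triangular one
way or the other (`exists_hasForm_or_of_charpoly`). In the wrong order, the cocycle restricted to
inertia is a homomorphism which conjugation by `φ` multiplies by `q⁻¹`, whereas the tame relation
(`map_conj_frobenius_eq`) demands `q`. As `q² ≠ 1` it vanishes on inertia, so the extension splits
and the order can be reversed.

Ramification comes from `HasForm.splitsOn_top`: `φ`, inertia and an open subgroup in the kernel
generate `G_v`, and a coboundary can be chosen to match any cocycle at `φ`. -/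

namespace Ideal

/-! ### Tame ramification in Dedekind domains. -/

section Tame

variable {R H : Type*} [CommRing R] [Group H] [MulSemiringAction H R] {P : Ideal R}

theorem smul_mem_pow_of_mem_stabilizer {τ : H} (hτ : τ ∈ MulAction.stabilizer H P) {n : ℕ} {z : R}
    (hz : z ∈ P ^ n) : τ • z ∈ P ^ n := by
  have hP : τ • P = P := hτ
  have h := mem_map_of_mem (MulSemiringAction.toRingHom H R τ) hz
  rw [Ideal.map_pow, ← pointwise_smul_def, hP] at h
  exact h

/-- An element of the inertia group acting trivially on `P / P ^ 2` acts trivially on all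
`P ^ n / P ^ (n + 1)`. -/
theorem smul_sub_mem_pow_succ {τ : H} (hτ : τ ∈ P.inertia H)
    (h : ∀ z ∈ P, τ • z - z ∈ P ^ 2) (n : ℕ) : ∀ z ∈ P ^ n, τ • z - z ∈ P ^ (n + 1) := by
  induction n with
  | zero => intro z _; simpa using hτ z
  | succ n ih =>
    intro z hz
    rw [pow_succ] at hz
    refine Submodule.mul_induction_on hz (fun a ha b hb ↦ ?_) (fun a b ha hb ↦ ?_)
    · have e : τ • (a * b) - a * b = (τ • a) * (τ • b - b) + (τ • a - a) * b := by
        rw [smul_mul']; ring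
      rw [e]
      refine add_mem ?_ ?_
      · rw [show n + 1 + 1 = n + 2 by ring, pow_add]
        exact mul_mem_mul (smul_mem_pow_of_mem_stabilizer (inertia_le_stabilizer P hτ) ha) (h b hb)
      · rw [pow_succ]
        exact mul_mem_mul (ih a ha) hb
    · rw [smul_add, add_sub_add_comm]
      exact add_mem ha hb

/-- An element of prime order acting trivially on `R / P` and on `P / P ^ 2`, the order being
nonzero in the residue field, acts trivially on `R`. -/
theorem smul_eq_self_of_pow_prime_eq_one [IsDomain R] [IsNoetherianRing R] [P.IsMaximal]
    {τ : H} (hτ : τ ∈ P.inertia H) (h : ∀ z ∈ P, τ • z - z ∈ P ^ 2) {ℓ : ℕ}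
    (hℓ : (ℓ : R) ∉ P) (hτℓ : τ ^ ℓ = 1) (x : R) : τ • x = x := by
  have key (n : ℕ) : ∀ x : R, τ • x - x ∈ P ^ n := by
    induction n with
    | zero => simp
    | succ n ih =>
      intro x
      have hk (k : ℕ) : τ ^ k • x - x - k * (τ • x - x) ∈ P ^ (n + 1) := by
        induction k with
        | zero => simp
        | succ k ihk =>
          have e : τ ^ (k + 1) • x - x - ((k + 1 : ℕ) : R) * (τ • x - x) =
              τ • (τ ^ k • x - x - k * (τ • x - x)) +
                k * (τ • (τ • x - x) - (τ • x - x)) := by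
            rw [pow_succ', mul_smul, smul_sub, smul_sub, smul_mul', smul_sub]
            have : τ • (k : R) = k := map_natCast (MulSemiringAction.toRingHom H R τ) k
            rw [this]; push_cast; ring
          rw [e]
          exact add_mem (smul_mem_pow_of_mem_stabilizer (inertia_le_stabilizer P hτ) ihk)
            (mul_mem_left _ _ (smul_sub_mem_pow_succ hτ h n _ (ih x)))
      have hℓx := hk ℓ
      rw [hτℓ, one_smul, sub_self, zero_sub, neg_mem_iff] at hℓx
      obtain ⟨y, hy⟩ : ∃ y, y * (ℓ : R) - 1 ∈ P := by
        obtain ⟨y, i, hi, hy⟩ := (inferInstance : P.IsMaximal).exists_inv hℓ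
        exact ⟨y, by rw [← hy]; simpa using hi⟩
      have e : τ • x - x = y * (ℓ * (τ • x - x)) - (τ • x - x) * (y * ℓ - 1) := by ring
      rw [e]
      refine sub_mem (mul_mem_left _ _ hℓx) ?_
      rw [pow_succ]
      exact mul_mem_mul (ih x) hy
  have : τ • x - x ∈ ⨅ n, P ^ n := by simpa [Submodule.mem_iInf] using fun n ↦ key n x
  rw [iInf_pow_eq_bot_of_isDomain P (IsPrime.ne_top inferInstance)] at this
  exact sub_eq_zero.mp this

/-- The inertia group acts on `P / P ^ 2` through scalars. -/
theorem exists_forall_smul_sub_mul_mem_sq [IsDedekindDomain R] [P.IsPrime] (hP : P ≠ ⊥)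
    {τ : H} (hτ : τ ∈ P.inertia H) : ∃ θ : R, ∀ z ∈ P, τ • z - θ * z ∈ P ^ 2 := by
  -- With `π` a uniformizer at `P`, the scalar `θ` is `τ π / π` modulo `P`.
  obtain ⟨π, hπ, hπ'⟩ := SetLike.exists_of_lt (pow_succ_lt_pow hP 1)
  have hτ' := inertia_le_stabilizer P hτ
  obtain ⟨θ, e, he, hθ⟩ := exists_mul_add_mem_pow_succ hP π (τ • π) hπ hπ'
    (smul_mem_pow_of_mem_stabilizer hτ' hπ)
  refine ⟨θ, fun z hz ↦ ?_⟩
  obtain ⟨a, f, hf, rfl⟩ := exists_mul_add_mem_pow_succ hP π z hπ hπ' (by simpa using hz)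
  have e1 : τ • (π * a + f) - θ * (π * a + f) =
      (τ • π) * (τ • a - a) + a * e + τ • f - θ * f := by
    rw [smul_add, smul_mul', ← hθ]; ring
  rw [e1]
  refine sub_mem (add_mem (add_mem ?_ (mul_mem_left _ _ he))
    (smul_mem_pow_of_mem_stabilizer hτ' hf)) (mul_mem_left _ _ hf)
  rw [pow_two]
  exact mul_mem_mul (by simpa using smul_mem_pow_of_mem_stabilizer hτ' hπ) (hτ a)

/-- The tame relation: if `τ` lies in the inertia group and `σ` acts on the residue field as
`x ↦ x ^ q`, then `σ τ σ⁻¹` and `τ ^ q` agree up to an element of order prime to every prime number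
that is nonzero in the residue field. -/
theorem not_dvd_orderOf_tame [IsDedekindDomain R] [P.IsMaximal] (hP : P ≠ ⊥) [FaithfulSMul H R]
    [Finite H] {σ τ : H} (hσ : σ ∈ MulAction.stabilizer H P) {q : ℕ}
    (hσq : ∀ x : R, σ • x - x ^ q ∈ P) (hτ : τ ∈ P.inertia H) {ℓ : ℕ} (hprime : ℓ.Prime)
    (hℓ : (ℓ : R) ∉ P) : ¬ ℓ ∣ orderOf (σ * τ * σ⁻¹ * (τ ^ q)⁻¹) := by
  have hconj : σ * τ * σ⁻¹ ∈ P.inertia H := fun x ↦ by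
    have h := smul_mem_pow_of_mem_stabilizer (n := 1) hσ (by simpa using hτ (σ⁻¹ • x))
    simpa [smul_sub, mul_smul] using h
  set ω := σ * τ * σ⁻¹ * (τ ^ q)⁻¹ with hω
  have hωI : ω ∈ P.inertia H := mul_mem hconj (inv_mem (pow_mem hτ q))
  -- If `τ` acts on `P / P ^ 2` by `θ`, then `σ τ σ⁻¹` acts by `σ θ ≡ θ ^ q`, exactly as `τ ^ q`
  -- does.
  have hω2 : ∀ z ∈ P, ω • z - z ∈ P ^ 2 := by
    obtain ⟨θ, hθ⟩ := exists_forall_smul_sub_mul_mem_sq hP hτ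
    have hstab {g : H} (hg : g ∈ MulAction.stabilizer H P) {z : R} (hz : z ∈ P) : g • z ∈ P := by
      simpa using smul_mem_pow_of_mem_stabilizer (n := 1) hg (by simpa using hz)
    have hpow (k : ℕ) : ∀ z ∈ P, τ ^ k • z - θ ^ k * z ∈ P ^ 2 := by
      induction k with
      | zero => simp
      | succ k ih =>
        intro z hz
        have e : τ ^ (k + 1) • z - θ ^ (k + 1) * z =
            (τ ^ k • (τ • z) - θ ^ k * (τ • z)) + θ ^ k * (τ • z - θ * z) := by
          rw [pow_succ, mul_smul]; ring
        rw [e]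
        exact add_mem (ih _ (hstab (inertia_le_stabilizer P hτ) hz))
          (mul_mem_left _ _ (hθ z hz))
    have hc : ∀ z ∈ P, (σ * τ * σ⁻¹) • z - θ ^ q * z ∈ P ^ 2 := by
      intro z hz
      have e : (σ * τ * σ⁻¹) • z - θ ^ q * z =
          σ • (τ • (σ⁻¹ • z) - θ * (σ⁻¹ • z)) + (σ • θ - θ ^ q) * z := by
        rw [smul_sub, smul_mul', smul_inv_smul, mul_smul, mul_smul]; ring
      rw [e]
      refine add_mem (smul_mem_pow_of_mem_stabilizer hσ (hθ _ (hstab (inv_mem hσ) hz))) ?_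
      rw [pow_two]
      exact mul_mem_mul (hσq θ) hz
    intro z hz
    have hz' := hstab (inv_mem (pow_mem (inertia_le_stabilizer P hτ) q)) hz
    have h := sub_mem (hc _ hz') (hpow q _ hz')
    simpa [hω, mul_smul] using h
  -- If `ω` had order `ℓ m`, then `ω ^ m` would be killed by `ℓ`, hence trivial, although `m < ℓ m`.
  intro hdvd
  obtain ⟨m, hm⟩ := hdvd
  have hpos := orderOf_pos ω
  have h2 (k : ℕ) : ∀ z ∈ P, ω ^ k • z - z ∈ P ^ 2 := by
    induction k with
    | zero => simp
    | succ k ih =>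
      intro z hz
      have e : ω ^ (k + 1) • z - z = ω ^ k • (ω • z - z) + (ω ^ k • z - z) := by
        rw [pow_succ, mul_smul, smul_sub]; ring
      rw [e]
      exact add_mem (smul_mem_pow_of_mem_stabilizer
        (pow_mem (inertia_le_stabilizer P hωI) k) (hω2 z hz)) (ih z hz)
  have h1 : ω ^ m = 1 := by
    refine FaithfulSMul.eq_of_smul_eq_smul (α := R) fun x ↦ ?_
    rw [one_smul]
    exact smul_eq_self_of_pow_prime_eq_one (pow_mem hωI m) (h2 m) hℓ
      (by rw [← pow_mul, mul_comm, ← hm, pow_orderOf_eq_one]) x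
  have hm0 : 0 < m := Nat.pos_of_ne_zero (by rintro rfl; omega)
  have := Nat.le_of_dvd hm0 (orderOf_dvd_of_pow_eq_one h1)
  rw [hm] at this
  nlinarith [hprime.two_le]

end Tame
end Ideal

namespace SpecialReduction

/-! ### Galois actions on rings of integers and residue fields. -/

section RingOfIntegers

variable {k L H : Type*} [Field k] [Field L] [Algebra k L] [Group H] [MulSemiringAction H L]

theorem algebraMap_smul_ringOfIntegers (g : H) (x : 𝓞 L) :
    algebraMap (𝓞 L) L (g • x) = g • algebraMap (𝓞 L) L x := rfl

instance smulCommClass_ringOfIntegers [SMulCommClass H k L] :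
    SMulCommClass H (𝓞 k) (𝓞 L) where
  smul_comm g a x := RingOfIntegers.coe_injective <| by
    rw [algebraMap_smul_ringOfIntegers, Algebra.smul_def, Algebra.smul_def, map_mul, map_mul,
      algebraMap_smul_ringOfIntegers, smul_mul', ← IsScalarTower.algebraMap_apply,
      IsScalarTower.algebraMap_apply (𝓞 k) k L, smul_algebraMap]

theorem isInvariant_ringOfIntegers [Algebra.IsInvariant k L H] :
    Algebra.IsInvariant (𝓞 k) (𝓞 L) H where
  isInvariant b hb := by
    obtain ⟨a, ha⟩ := Algebra.IsInvariant.isInvariant (A := k) (G := H) (b : L)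
      fun g ↦ congrArg (algebraMap (𝓞 L) L) (hb g)
    have hint : IsIntegral ℤ a := (isIntegral_algebraMap_iff (algebraMap k L).injective).mp
      (ha ▸ RingOfIntegers.isIntegral_coe b)
    exact ⟨⟨a, hint⟩, RingOfIntegers.ext ha⟩

instance faithfulSMul_ringOfIntegers [NumberField L] [FaithfulSMul H L] :
    FaithfulSMul H (𝓞 L) where
  eq_of_smul_eq_smul {g h} hgh := FaithfulSMul.eq_of_smul_eq_smul (α := L) fun x ↦ by
    obtain ⟨a, b, hb, rfl⟩ := IsFractionRing.div_surjective (A := 𝓞 L) x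
    simp only [div_eq_mul_inv, smul_mul', smul_inv'', ← algebraMap_smul_ringOfIntegers, hgh]

/-- For a profinite group acting continuously on `L`, every automorphism of the residue field
of a prime `w` of `𝓞 L` over that of the fixed field comes from the stabilizer of `w`. -/
theorem exists_mem_stabilizer_forall_sub_mem [SMulCommClass H k L] [Algebra.IsInvariant k L H]
    [TopologicalSpace H] [CompactSpace H] [TotallyDisconnectedSpace H] [IsTopologicalGroup H]
    (hopen : ∀ x : L, IsOpen (MulAction.stabilizer H x : Set H))
    (w : Ideal (𝓞 L)) [w.IsPrime] (σ : (𝓞 L ⧸ w) ≃ₐ[𝓞 k ⧸ w.under (𝓞 k)] (𝓞 L ⧸ w)) :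
    ∃ g ∈ MulAction.stabilizer H w, ∀ x : 𝓞 L,
      Ideal.Quotient.mk w (g • x) = σ (Ideal.Quotient.mk w x) := by
  -- For the discrete topology, open stabilizers amount to continuity of the action.
  let _ : TopologicalSpace (𝓞 L) := ⊥
  have : DiscreteTopology (𝓞 L) := ⟨rfl⟩
  have : ContinuousSMul H (𝓞 L) := continuousSMul_iff_stabilizer_isOpen.mpr fun x ↦ by
    convert hopen (x : L) using 2
    ext g
    exact RingOfIntegers.ext_iff
  have := isInvariant_ringOfIntegers (k := k) (L := L) (H := H)
  obtain ⟨g, hg⟩ :=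
    Ideal.Quotient.stabilizerHom_surjective_of_profinite (G := H) (w.under (𝓞 k)) w σ
  exact ⟨g, g.2, fun x ↦ by rw [← hg]; rfl⟩

end RingOfIntegers

/-! ### Lifting residue field automorphisms. -/

section Decomposition

variable {F : Type*} [Field F]

/-- The residue field of `w` is algebraic over a finite field, so its `q`-power map is an
automorphism, which lifts to the decomposition group. -/
theorem exists_isArithFrobAt [NumberField F] (w : Ideal (𝓞 (AlgebraicClosure F))) [w.IsPrime]
    (hw : w.under (𝓞 F) ≠ ⊥) : ∃ φ : AbsGal F, IsArithFrobAt (𝓞 F) φ w := by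
  have : (w.under (𝓞 F)).IsMaximal := Ideal.IsPrime.isMaximal inferInstance hw
  have : w.IsMaximal := Ideal.isMaximal_of_isIntegral_of_isMaximal_comap (R := 𝓞 F) w ‹_›
  let _ := Ideal.Quotient.field (w.under (𝓞 F))
  let _ := Ideal.Quotient.field w
  have : Finite (𝓞 F ⧸ w.under (𝓞 F)) := Ideal.finiteQuotientOfFreeOfNeBot _ hw
  let _ := Fintype.ofFinite (𝓞 F ⧸ w.under (𝓞 F))
  have : Algebra.IsInvariant F (AlgebraicClosure F) (AbsGal F) :=
    ⟨fun b hb ↦ (InfiniteGalois.mem_range_algebraMap_iff_fixed b).mpr hb⟩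
  have : Algebra.IsAlgebraic (𝓞 F ⧸ w.under (𝓞 F)) (𝓞 (AlgebraicClosure F) ⧸ w) := inferInstance
  obtain ⟨φ, hφ, h⟩ := exists_mem_stabilizer_forall_sub_mem (k := F) (H := AbsGal F)
    stabilizer_isOpen_of_isIntegral w (FiniteField.frobeniusAlgEquivOfAlgebraic _ _)
  refine ⟨φ, fun x ↦ ?_⟩
  rw [← Ideal.Quotient.eq]
  simpa using h x

/-- The residual action of `g` is linear over the residue field of `E`, so it lifts to the Galois
group over `E`. This separates `g` into a part fixing `E` and an inertial part. -/
theorem exists_mem_fixingSubgroup_sub_mem [CharZero F]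
    (E : IntermediateField F (AlgebraicClosure F))
    [FiniteDimensional F E] (w : Ideal (𝓞 (AlgebraicClosure F))) [w.IsPrime]
    {g : AbsGal F} (hg : g ∈ decompositionGroup w)
    (hgE : ∀ x : 𝓞 E, g • algebraMap (𝓞 E) (𝓞 (AlgebraicClosure F)) x -
      algebraMap (𝓞 E) (𝓞 (AlgebraicClosure F)) x ∈ w) :
    ∃ u ∈ E.fixingSubgroup, u ∈ decompositionGroup w ∧
      ∀ x : 𝓞 (AlgebraicClosure F), u • x - g • x ∈ w := by
  have : Algebra.IsInvariant E (AlgebraicClosure F) E.fixingSubgroup := ⟨fun b hb ↦ by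
    have : b ∈ IntermediateField.fixedField E.fixingSubgroup := hb
    rw [InfiniteGalois.fixedField_fixingSubgroup] at this
    exact ⟨⟨b, this⟩, rfl⟩⟩
  have : CompactSpace E.fixingSubgroup :=
    isCompact_iff_compactSpace.mp E.fixingSubgroup_isClosed.isCompact
  have : SMulCommClass E.fixingSubgroup E (AlgebraicClosure F) :=
    ⟨fun u a x ↦ by
      have := u.2 a
      simp only [Algebra.smul_def, smul_mul']
      congr 1⟩
  let σ : (𝓞 (AlgebraicClosure F) ⧸ w) ≃ₐ[𝓞 E ⧸ w.under (𝓞 E)] (𝓞 (AlgebraicClosure F) ⧸ w) :=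
    { Ideal.quotientEquiv w w (MulSemiringAction.toRingEquiv (AbsGal F) _ g) hg.symm with
      commutes' := by
        rintro ⟨x⟩
        exact Ideal.Quotient.eq.mpr (hgE x) }
  obtain ⟨u, hu, h⟩ := exists_mem_stabilizer_forall_sub_mem (k := E) (H := E.fixingSubgroup)
    (fun x ↦ (stabilizer_isOpen_of_isIntegral (K := F) x).preimage continuous_subtype_val) w σ
  exact ⟨u, u.2, hu, fun x ↦ Ideal.Quotient.eq.mp (h x)⟩

end Decomposition
end SpecialReduction

namespace SpecialReduction

/-! ### Generators of the decomposition group and the tame relation. -/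

section FrobeniusAndInertia

variable {F : Type*} [Field F] (E : IntermediateField F (AlgebraicClosure F))
  [Normal F E] {w : Ideal (𝓞 (AlgebraicClosure F))}

theorem algebraMap_restrictNormalHom_smul (g : AbsGal F) (x : 𝓞 E) :
    algebraMap (𝓞 E) (𝓞 (AlgebraicClosure F)) (AlgEquiv.restrictNormalHom E g • x) =
      g • algebraMap (𝓞 E) (𝓞 (AlgebraicClosure F)) x :=
  RingOfIntegers.coe_injective <|
    AlgEquiv.restrictNormal_commutes (χ := g) (E := E) (algebraMap (𝓞 E) E x)

theorem smul_mem_iff_of_mem_decompositionGroup {g : AbsGal F} (hg : g ∈ decompositionGroup w)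
    (x : 𝓞 (AlgebraicClosure F)) : g • x ∈ w ↔ x ∈ w := by
  conv_lhs => rw [← show g • w = w from hg, Ideal.smul_mem_pointwise_smul_iff]

theorem restrictNormalHom_mem_stabilizer {g : AbsGal F} (hg : g ∈ decompositionGroup w) :
    AlgEquiv.restrictNormalHom E g ∈ MulAction.stabilizer (E ≃ₐ[F] E) (w.under (𝓞 E)) := by
  refine MulAction.mem_stabilizer_iff.mpr (Ideal.ext fun x ↦ ?_)
  rw [Ideal.mem_pointwise_smul_iff_inv_smul_mem, ← map_inv, Ideal.mem_comap, Ideal.mem_comap,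
    algebraMap_restrictNormalHom_smul, smul_mem_iff_of_mem_decompositionGroup (inv_mem hg)]

theorem _root_.IsArithFrobAt.pow_smul_sub_mem {φ : AbsGal F} (hφ : IsArithFrobAt (𝓞 F) φ w) (n : ℕ)
    (x : 𝓞 (AlgebraicClosure F)) : φ ^ n • x - x ^ Nat.card (𝓞 F ⧸ w.under (𝓞 F)) ^ n ∈ w := by
  induction n generalizing x with
  | zero => simp
  | succ n ih =>
    have h1 := ih (φ • x)
    rw [← mul_smul, ← pow_succ] at h1
    have h2 := w.mem_of_dvd (sub_dvd_pow_sub_pow (φ • x)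
      (x ^ Nat.card (𝓞 F ⧸ w.under (𝓞 F))) (Nat.card (𝓞 F ⧸ w.under (𝓞 F)) ^ n)) (hφ x)
    have h := add_mem h1 h2
    rwa [sub_add_sub_cancel, ← pow_mul, ← pow_succ'] at h

/-- The decomposition group is topologically generated by a Frobenius element and the inertia
group. -/
theorem eq_top_of_frobenius_mem_of_inertia_le [NumberField F] [FiniteDimensional F E] [w.IsPrime]
    (hw : w.under (𝓞 F) ≠ ⊥) {φ : decompositionGroup w}
    (hφ : IsArithFrobAt (𝓞 F) (φ : AbsGal F) w) {S : Subgroup (decompositionGroup w)} (hφS : φ ∈ S)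
    (hIS : inertiaGroup w ≤ S)
    (hES : ∀ u : decompositionGroup w, (u : AbsGal F) ∈ E.fixingSubgroup → u ∈ S) : S = ⊤ := by
  have : NumberField E := NumberField.of_module_finite F E
  set P := w.under (𝓞 E) with hPdef
  have hP : P ≠ ⊥ := fun h ↦ hw <| by
    rw [← Ideal.under_under (A := 𝓞 F) (B := 𝓞 E), ← hPdef, h]
    exact Ideal.under_bot _ _
  have : P.IsMaximal := Ideal.IsPrime.isMaximal inferInstance hP
  have : (w.under (𝓞 F)).IsMaximal := Ideal.IsPrime.isMaximal inferInstance hw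
  have : P.LiesOver (w.under (𝓞 F)) := ⟨(Ideal.under_under (B := 𝓞 E) w).symm⟩
  let _ := Ideal.Quotient.field (w.under (𝓞 F))
  let _ := Ideal.Quotient.field P
  have : Finite (𝓞 F ⧸ w.under (𝓞 F)) := Ideal.finiteQuotientOfFreeOfNeBot _ hw
  have : Finite (𝓞 E ⧸ P) := Ideal.finiteQuotientOfFreeOfNeBot _ hP
  let _ := Fintype.ofFinite (𝓞 F ⧸ w.under (𝓞 F))
  refine eq_top_iff.mpr fun g _ ↦ ?_
  -- The residue extension of `E` is finite, so its Galois group consists of powers of Frobenius.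
  obtain ⟨n, hn⟩ := (FiniteField.bijective_frobeniusAlgEquivOfAlgebraic_pow
    (𝓞 F ⧸ w.under (𝓞 F)) (𝓞 E ⧸ P)).2 (Ideal.Quotient.stabilizerHom P (w.under (𝓞 F)) (E ≃ₐ[F] E)
      ⟨_, restrictNormalHom_mem_stabilizer E g.2⟩)
  have hg (x : 𝓞 E) : (g : AbsGal F) • algebraMap (𝓞 E) (𝓞 (AlgebraicClosure F)) x -
      (φ : AbsGal F) ^ (n : ℕ) • algebraMap (𝓞 E) (𝓞 (AlgebraicClosure F)) x ∈ w := by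
    have h1 := DFunLike.congr_fun hn (Ideal.Quotient.mk P x)
    simp only [AlgEquiv.coe_pow, FiniteField.coe_frobeniusAlgEquivOfAlgebraic, pow_iterate,
      Fintype.card_eq_nat_card] at h1
    rw [Ideal.Quotient.stabilizerHom_apply, ← map_pow, Ideal.Quotient.eq] at h1
    have h2 : algebraMap (𝓞 E) (𝓞 (AlgebraicClosure F))
        (x ^ Nat.card (𝓞 F ⧸ w.under (𝓞 F)) ^ (n : ℕ) -
          AlgEquiv.restrictNormalHom E (g : AbsGal F) • x) ∈ w := h1
    rw [map_sub, map_pow, algebraMap_restrictNormalHom_smul] at h2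
    have h3 := add_mem (hφ.pow_smul_sub_mem n (algebraMap (𝓞 E) (𝓞 (AlgebraicClosure F)) x)) h2
    rwa [sub_add_sub_cancel, ← neg_mem_iff, neg_sub] at h3
  obtain ⟨u, huE, hu, h⟩ := exists_mem_fixingSubgroup_sub_mem E w
    (g := ((φ ^ (n : ℕ))⁻¹ * g : decompositionGroup w)) (SetLike.coe_mem _) fun x ↦ by
      rw [← smul_mem_iff_of_mem_decompositionGroup (φ ^ (n : ℕ)).2]
      simpa [smul_sub, mul_smul] using hg x
  -- Thus `g` is the product of `φ ^ n`, an element fixing `E`, and an inertia element.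
  have hI : (⟨u, hu⟩ : decompositionGroup w)⁻¹ * ((φ ^ (n : ℕ))⁻¹ * g) ∈ inertiaGroup w := by
    intro x
    change (u⁻¹ * ((φ ^ (n : ℕ))⁻¹ * g : decompositionGroup w) : AbsGal F) • x - x ∈ w
    rw [← smul_mem_iff_of_mem_decompositionGroup hu, smul_sub, mul_smul, smul_inv_smul,
      ← neg_mem_iff, neg_sub]
    exact h x
  have := S.mul_mem (S.mul_mem (S.pow_mem hφS n) (hES ⟨u, hu⟩ huE)) (hIS hI)
  simpa [mul_assoc] using this

/-- The tame relation, for homomorphisms from the inertia group to a field of characteristic prime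
to the residue characteristic. -/
theorem map_conj_frobenius_eq [NumberField F] [FiniteDimensional F E] [w.IsPrime]
    (hw : w.under (𝓞 F) ≠ ⊥) {φ : decompositionGroup w}
    (hφ : IsArithFrobAt (𝓞 F) (φ : AbsGal F) w) {k : Type*} [Field k] {ℓ : ℕ} [Fact ℓ.Prime]
    [CharP k ℓ] (hℓ : (ℓ : 𝓞 F) ∉ w.under (𝓞 F)) {f : decompositionGroup w → k}
    (hf : ∀ a ∈ inertiaGroup w, ∀ b ∈ inertiaGroup w, f (a * b) = f a + f b)
    (hfE : ∀ u ∈ inertiaGroup w, (u : AbsGal F) ∈ E.fixingSubgroup → f u = 0)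
    {τ : decompositionGroup w} (hτ : τ ∈ inertiaGroup w) :
    f (φ * τ * φ⁻¹) = (Nat.card (𝓞 F ⧸ w.under (𝓞 F)) : k) * f τ := by
  have : NumberField E := NumberField.of_module_finite F E
  set P := w.under (𝓞 E) with hPdef
  have hP : P ≠ ⊥ := fun h ↦ hw <| by
    rw [← Ideal.under_under (A := 𝓞 F) (B := 𝓞 E), ← hPdef, h]
    exact Ideal.under_bot _ _
  have : P.IsMaximal := Ideal.IsPrime.isMaximal inferInstance hP
  set q := Nat.card (𝓞 F ⧸ w.under (𝓞 F))
  let r : decompositionGroup w →* (E ≃ₐ[F] E) :=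
    (AlgEquiv.restrictNormalHom E).comp (decompositionGroup w).subtype
  have hr (g : decompositionGroup w) (x : 𝓞 E) :
      algebraMap (𝓞 E) (𝓞 (AlgebraicClosure F)) (r g • x) =
        (g : AbsGal F) • algebraMap (𝓞 E) (𝓞 (AlgebraicClosure F)) x :=
    algebraMap_restrictNormalHom_smul E g x
  have hpow (a : decompositionGroup w) (ha : a ∈ inertiaGroup w) (n : ℕ) : f (a ^ n) = n * f a := by
    induction n with
    | zero => simpa using hfE 1 (one_mem _) (one_mem _)
    | succ n ih => rw [pow_succ, hf _ (pow_mem ha n) _ ha, ih]; push_cast; ring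
  have hndvd := Ideal.not_dvd_orderOf_tame hP (σ := r φ) (τ := r τ) (q := q) (ℓ := ℓ)
    (restrictNormalHom_mem_stabilizer E φ.2)
    (fun x ↦ by
      rw [Ideal.mem_comap, map_sub, map_pow, hr]
      exact hφ _)
    (fun x ↦ by
      change r τ • x - x ∈ w.under (𝓞 E)
      rw [Ideal.mem_comap, map_sub, hr]
      exact hτ _)
    Fact.out
    (by
      rw [← map_natCast (algebraMap (𝓞 F) (𝓞 E))]
      exact fun h ↦ hℓ (by rwa [← Ideal.under_under (A := 𝓞 F) (B := 𝓞 E)]))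
  have hnormal : (inertiaGroup w).Normal := inferInstance
  have hconj := hnormal.conj_mem τ hτ φ
  set ω := φ * τ * φ⁻¹ * (τ ^ q)⁻¹ with hω
  have hωI : ω ∈ inertiaGroup w := mul_mem hconj (inv_mem (pow_mem hτ q))
  have hrω : r φ * r τ * (r φ)⁻¹ * (r τ ^ q)⁻¹ = r ω := by simp [hω]
  rw [hrω] at hndvd
  -- A power of `ω` with exponent prime to `ℓ` fixes `E`, so `f` kills it; that exponent is
  -- invertible in `k`.
  have hfω : f ω = 0 := by
    have h : f (ω ^ orderOf (r ω)) = 0 := hfE _ (pow_mem hωI _) <| by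
      rw [← IntermediateField.restrictNormalHom_ker, MonoidHom.mem_ker]
      exact (map_pow r ω _).trans (pow_orderOf_eq_one _)
    rw [hpow ω hωI] at h
    exact (mul_eq_zero.mp h).resolve_left fun h0 ↦ hndvd ((CharP.cast_eq_zero_iff k ℓ _).mp h0)
  have : φ * τ * φ⁻¹ = ω * τ ^ q := by simp [hω]
  rw [this, hf _ hωI _ (pow_mem hτ q), hfω, zero_add, hpow τ hτ]

end FrobeniusAndInertia

/-! ### The cyclotomic character modulo `ℓ`. -/

section Cyclotomic

variable {F : Type*} [Field F]

/-- Away from `ℓ`, a primitive `ℓ`-th root of unity keeps its order modulo `w`, so the residual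
action of `g` determines its exponent modulo `ℓ`. Frobenius is the case `n = q`, inertia the case `n
= 1`. -/
theorem map_cyclotomic_eq_natCast [CharZero F] {w : Ideal (𝓞 (AlgebraicClosure F))} [w.IsPrime]
    {ℓ : ℕ} [Fact ℓ.Prime] (hℓ : (ℓ : 𝓞 (AlgebraicClosure F)) ∉ w) {g : AbsGal F} {n : ℕ}
    (hg : ∀ x : 𝓞 (AlgebraicClosure F), g • x - x ^ n ∈ w)
    {k : Type*} [CommRing k] [CharP k ℓ] (ψ : ℤ_[ℓ] →+* k) : ψ (cyclotomic F ℓ g) = n := by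
  have hprime : ℓ.Prime := Fact.out
  have h1 : PadicInt.toZModPow 1 (cyclotomic F ℓ g : ℤ_[ℓ]) = n := by
    have : NeZero (ℓ : AlgebraicClosure F) := ⟨by simpa using hprime.ne_zero⟩
    obtain ⟨ζ, hζ⟩ := HasEnoughRootsOfUnity.exists_primitiveRoot (AlgebraicClosure F) ℓ
    have hspec := cyclotomicCharacter.spec (L := AlgebraicClosure F) ℓ (n := 1)
      (MulSemiringAction.toRingAut (AbsGal F) (AlgebraicClosure F) g) ζ
      (by simpa using hζ.pow_eq_one)
    set a := PadicInt.toZModPow 1 (cyclotomic F ℓ g : ℤ_[ℓ])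
    let z : 𝓞 (AlgebraicClosure F) := ⟨ζ, hζ.isIntegral hprime.pos⟩
    have hz : IsPrimitiveRoot z ℓ :=
      IsPrimitiveRoot.of_map_of_injective
        (f := algebraMap (𝓞 (AlgebraicClosure F)) (AlgebraicClosure F)) hζ
        RingOfIntegers.coe_injective
    have hgz : g • z = z ^ a.val := RingOfIntegers.coe_injective hspec
    set y := Ideal.Quotient.mk w z with hy
    have hyℓ : y ^ ℓ = 1 := by rw [hy, ← map_pow, hz.pow_eq_one, map_one]
    have hy1 : y ≠ 1 := by
      intro h
      -- If `ζ` reduced to `1`, the relation `1 + ζ + ⋯ + ζ ^ (ℓ - 1) = 0` would put `ℓ` in `w`.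
      have h2 := congrArg (Ideal.Quotient.mk w) (hz.geom_sum_eq_zero hprime.one_lt)
      simp only [map_sum, map_pow, ← hy, h, one_pow, Finset.sum_const, Finset.card_range,
        nsmul_eq_mul, mul_one, map_zero] at h2
      exact hℓ (Ideal.Quotient.eq_zero_iff_mem.mp (by simpa using h2))
    have hord : orderOf y = ℓ := orderOf_eq_prime hyℓ hy1
    have hpow : y ^ a.val = y ^ n := by
      rw [hy, ← map_pow, ← map_pow, ← hgz]
      exact Ideal.Quotient.eq.mpr (hg z)
    rw [IsOfFinOrder.pow_eq_pow_iff_modEq (isOfFinOrder_iff_pow_eq_one.mpr ⟨ℓ, hprime.pos, hyℓ⟩),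
      hord] at hpow
    have : NeZero (ℓ ^ 1) := ⟨pow_ne_zero 1 hprime.ne_zero⟩
    rw [← ZMod.natCast_zmod_val a]
    exact (ZMod.natCast_eq_natCast_iff _ _ _).mpr (by simpa only [pow_one] using hpow)
  have h2 : (cyclotomic F ℓ g : ℤ_[ℓ]) - n ∈ RingHom.ker (PadicInt.toZModPow (p := ℓ) 1) := by
    rw [RingHom.mem_ker, map_sub, h1, map_natCast, sub_self]
  rw [PadicInt.ker_toZModPow, Ideal.mem_span_singleton] at h2
  obtain ⟨c, hc⟩ := h2
  have h3 := congrArg ψ hc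
  rw [pow_one, map_mul, map_natCast, CharP.cast_eq_zero k ℓ, zero_mul, map_sub, map_natCast] at h3
  exact sub_eq_zero.mp h3

end Cyclotomic
end SpecialReduction

namespace SpecialReduction

/-! ### Two-dimensional representations with prescribed characters. -/

section Representations

variable {Γ k : Type*} [Group Γ] [Field k]

/-- A two by two matrix with distinct eigenvalues is diagonalizable. -/
theorem exists_conj_eq_diagonal {M : GL (Fin 2) k} {a b : k} (hab : a ≠ b)
    (ha : M.val.charpoly.IsRoot a) (hb : M.val.charpoly.IsRoot b) :
    ∃ P : GL (Fin 2) k, (P * M * P⁻¹).val = !![a, 0; 0, b] := by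
  have hev {c : k} (hc : M.val.charpoly.IsRoot c) : ∃ v ≠ 0, M.val.mulVec v = c • v := by
    rw [Polynomial.IsRoot, Matrix.eval_charpoly] at hc
    obtain ⟨v, hv, h⟩ := Matrix.exists_mulVec_eq_zero_iff.mpr hc
    refine ⟨v, hv, ?_⟩
    rw [Matrix.sub_mulVec, sub_eq_zero] at h
    rw [← h]
    simp
  obtain ⟨v, hv, hva⟩ := hev ha
  obtain ⟨u, hu, hub⟩ := hev hb
  let Q : Matrix (Fin 2) (Fin 2) k := (Matrix.of ![v, u]).transpose
  have hQv (x : Fin 2 → k) : Q.mulVec x = x 0 • v + x 1 • u := by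
    ext i
    simp [Q, Matrix.mulVec, dotProduct, Fin.sum_univ_two, mul_comm]
  have hQ : Q.det ≠ 0 := by
    intro h
    obtain ⟨x, hx, hQx⟩ := Matrix.exists_mulVec_eq_zero_iff.mpr h
    rw [hQv] at hQx
    have h1 : x 0 • a • v + x 1 • b • u = 0 := by
      have := congrArg M.val.mulVec hQx
      rwa [Matrix.mulVec_add, Matrix.mulVec_smul, Matrix.mulVec_smul, hva, hub,
        Matrix.mulVec_zero] at this
    -- Subtracting `b` times the linear relation from its image under `M` eliminates `u`.
    have h2 : (x 0 * (a - b)) • v = 0 := by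
      have e : (x 0 * (a - b)) • v =
          (x 0 • a • v + x 1 • b • u) - b • (x 0 • v + x 1 • u) := by
        module
      rw [e, h1, hQx]; simp
    have h3 : x 0 = 0 := by
      have := (smul_eq_zero.mp h2).resolve_right hv
      exact (mul_eq_zero.mp this).resolve_right (sub_ne_zero.mpr hab)
    rw [h3, zero_smul, zero_add] at hQx
    have h4 : x 1 = 0 := (smul_eq_zero.mp hQx).resolve_right hu
    exact hx (by ext i; fin_cases i <;> assumption)
  let Q' := Matrix.GeneralLinearGroup.mkOfDetNeZero Q hQ
  let D : Matrix (Fin 2) (Fin 2) k := !![a, 0; 0, b]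
  have hMQ : M.val * Q = Q * D := by
    ext i j
    have h0 := congrFun hva i
    have h1 := congrFun hub i
    simp only [Matrix.mulVec, dotProduct, Fin.sum_univ_two, Pi.smul_apply, smul_eq_mul] at h0 h1
    fin_cases j
    · simpa [Matrix.mul_apply, Q, D, Fin.sum_univ_two, mul_comm a] using h0
    · simpa [Matrix.mul_apply, Q, D, Fin.sum_univ_two, mul_comm b] using h1
  refine ⟨Q'⁻¹, ?_⟩
  rw [inv_inv, mul_assoc, Units.val_mul, Units.val_mul]
  change (Q'⁻¹).val * (M.val * Q) = D
  rw [hMQ, ← mul_assoc]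
  change (Q'⁻¹).val * Q'.val * D = D
  rw [← Units.val_mul, inv_mul_cancel, Units.val_one, one_mul]

theorem HasForm.apply_mul {σ : Γ →* GL (Fin 2) k} {α β : Γ →* kˣ} {ν : Γ → k}
    (h : HasForm σ α β ν) (a b : Γ) : ν (a * b) = α a * ν b + ν a * β b := by
  obtain ⟨P, hP⟩ := h
  have e : P * σ (a * b) * P⁻¹ = (P * σ a * P⁻¹) * (P * σ b * P⁻¹) := by
    rw [map_mul]; group
  have h1 := congrArg Units.val e
  rw [Units.val_mul (P * σ a * P⁻¹), hP, hP, hP] at h1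
  simpa [Matrix.mul_apply, Fin.sum_univ_two] using congrFun (congrFun h1 0) 1

theorem HasForm.apply_eq_zero {σ : Γ →* GL (Fin 2) k} {α β : Γ →* kˣ} {ν : Γ → k}
    (h : HasForm σ α β ν) {u : Γ} (hu : σ u = 1) : ν u = 0 ∧ α u = 1 ∧ β u = 1 := by
  obtain ⟨P, hP⟩ := h
  have h1 := hP u
  rw [hu, mul_one, mul_inv_cancel, Units.val_one] at h1
  refine ⟨by simpa using (congrFun (congrFun h1 0) 1).symm,
    Units.ext (by simpa using (congrFun (congrFun h1 0) 0).symm),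
    Units.ext (by simpa using (congrFun (congrFun h1 1) 1).symm)⟩

theorem HasForm.swap {σ : Γ →* GL (Fin 2) k} {α β : Γ →* kˣ} {ν : Γ → k}
    (h : HasForm σ α β ν) (hν : ∀ g, ν g = 0) : HasForm σ β α ν := by
  obtain ⟨P, hP⟩ := h
  let J : GL (Fin 2) k := ⟨!![0, 1; 1, 0], !![0, 1; 1, 0],
    by simp [Matrix.one_fin_two], by simp [Matrix.one_fin_two]⟩
  refine ⟨J * P, fun g ↦ ?_⟩
  have e : J * P * σ g * (J * P)⁻¹ = J * (P * σ g * P⁻¹) * J⁻¹ := by group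
  rw [e, Units.val_mul, Units.val_mul, hP, hν]
  simp [J]

/-- A two-dimensional representation whose characteristic polynomials are those of `α ⊕ β`, and
for which some `φ` separates `α` and `β`, is an extension of one of the characters by the other,
and this extension splits on `φ`. -/
theorem exists_hasForm_or_of_charpoly {σ : Γ →* GL (Fin 2) k} {α β : Γ →* kˣ}
    (hσ : ∀ g, (σ g).val.charpoly = (Polynomial.X - Polynomial.C (α g : k)) *
      (Polynomial.X - Polynomial.C (β g : k))) {φ : Γ} (hφ : (α φ : k) ≠ β φ) :
    ∃ ν : Γ → k, ν φ = 0 ∧ (HasForm σ α β ν ∨ HasForm σ β α ν) := by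
  obtain ⟨P, hP⟩ := exists_conj_eq_diagonal hφ (M := σ φ) (by simp [hσ]) (by simp [hσ])
  let N : Γ →* GL (Fin 2) k := (MulAut.conj P).toMonoidHom.comp σ
  have hN (g : Γ) : N g = P * σ g * P⁻¹ := rfl
  have hNchar (g : Γ) : (N g).val.charpoly = (Polynomial.X - Polynomial.C (α g : k)) *
      (Polynomial.X - Polynomial.C (β g : k)) := by
    rw [hN, Units.val_mul, Units.val_mul, ← hσ, Matrix.coe_units_inv]
    exact Matrix.charpoly_units_conj P (σ g).val
  have hdet (g : Γ) : (N g).val 0 0 * (N g).val 1 1 - (N g).val 0 1 * (N g).val 1 0 =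
      α g * β g := by
    have h := congrArg (Polynomial.eval 0) (hNchar g)
    simpa [Matrix.charpoly_fin_two, Matrix.det_fin_two] using h
  have htr (g : Γ) : (N g).val 0 0 + (N g).val 1 1 = α g + β g := by
    have h := congrArg (Polynomial.eval 1) (hNchar g)
    rw [Matrix.charpoly_fin_two, Matrix.trace_fin_two, Matrix.det_fin_two, hdet] at h
    simp only [Polynomial.eval_add, Polynomial.eval_sub, Polynomial.eval_mul, Polynomial.eval_pow,
      Polynomial.eval_X, Polynomial.eval_C] at h
    linear_combination -h
  have hmul (g h : Γ) (i j : Fin 2) : (N (g * h)).val i j =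
      (N g).val i 0 * (N h).val 0 j + (N g).val i 1 * (N h).val 1 j := by
    rw [map_mul, Units.val_mul, Matrix.mul_apply, Fin.sum_univ_two]
  have hNφ : (N φ).val = !![(α φ : k), 0; 0, (β φ : k)] := hP
  -- The traces of `g` and `φ g` give two linear equations for the diagonal entries, independent
  -- since `α φ ≠ β φ`.
  have hdiag (g : Γ) : (N g).val 0 0 = α g ∧ (N g).val 1 1 = β g := by
    have h1 := htr g
    have h2 := htr (φ * g)
    rw [hmul, hmul, hNφ] at h2
    simp at h2
    have h3 : ((α φ : k) - β φ) * ((N g).val 0 0 - α g) = 0 := by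
      linear_combination h2 - (β φ : k) * h1
    have h4 := sub_eq_zero.mp ((mul_eq_zero.mp h3).resolve_left (sub_ne_zero.mpr hφ))
    exact ⟨h4, by linear_combination h1 - h4⟩
  -- The upper left entry is the character `α`, so the cross term in its product formula vanishes;
  -- as `g` and `h` are independent, one off-diagonal entry is identically zero.
  have hoff (g h : Γ) : (N g).val 0 1 * (N h).val 1 0 = 0 := by
    have h1 := hmul g h 0 0
    rw [(hdiag _).1, (hdiag _).1, (hdiag _).1, map_mul, Units.val_mul] at h1
    linear_combination -h1
  by_cases hc : ∀ h, (N h).val 1 0 = 0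
  · refine ⟨fun g ↦ (N g).val 0 1, by simp [hNφ], Or.inl ⟨P, fun g ↦ ?_⟩⟩
    rw [← hN]
    ext i j
    fin_cases i <;> fin_cases j <;> simp [hdiag, hc]
  · push Not at hc
    obtain ⟨h, hh⟩ := hc
    have hb (g : Γ) : (N g).val 0 1 = 0 := (mul_eq_zero.mp (hoff g h)).resolve_right hh
    let J : GL (Fin 2) k := ⟨!![0, 1; 1, 0], !![0, 1; 1, 0],
      by simp [Matrix.one_fin_two], by simp [Matrix.one_fin_two]⟩
    refine ⟨fun g ↦ (N g).val 1 0, by simp [hNφ], Or.inr ⟨J * P, fun g ↦ ?_⟩⟩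
    have e : J * P * σ g * (J * P)⁻¹ = J * N g * J⁻¹ := by rw [hN]; group
    have e2 : (N g).val = !![(α g : k), 0; (N g).val 1 0, (β g : k)] := by
      ext i j
      fin_cases i <;> fin_cases j <;> simp [hdiag, hb]
    rw [e, Units.val_mul, Units.val_mul, e2]
    simp [J]

/-- If `Γ` is generated by `φ`, `I` and the kernel of `σ`, an extension that splits on `I` splits,
provided that its characters agree on `I` and differ at `φ`. -/
theorem HasForm.splitsOn_top {σ : Γ →* GL (Fin 2) k} {α β : Γ →* kˣ} {ν : Γ → k}
    (h : HasForm σ α β ν) {φ : Γ} {I : Subgroup Γ}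
    (hgen : ∀ S : Subgroup Γ, φ ∈ S → I ≤ S → σ.ker ≤ S → S = ⊤)
    (hI : ∀ τ ∈ I, α τ = β τ) (hφ : (α φ : k) ≠ β φ) (hν : SplitsOn I α β ν) :
    SplitsOn ⊤ α β ν := by
  obtain ⟨s, hs⟩ := hν
  -- This `t` is forced by agreement at `φ`; `S` is the subgroup on which `ν` equals the resulting
  -- coboundary.
  let t : k := ν φ / (α φ - β φ)
  let S : Subgroup Γ :=
    { carrier := {g | ν g = t * ((α g : k) - β g)}
      one_mem' := by simp [(h.apply_eq_zero (map_one σ)).1]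
      mul_mem' := fun {a b} ha hb ↦ by
        simp only [Set.mem_ofPred_eq] at ha hb ⊢
        rw [h.apply_mul, ha, hb, map_mul, map_mul, Units.val_mul, Units.val_mul]
        ring
      inv_mem' := fun {a} ha ↦ by
        simp only [Set.mem_ofPred_eq] at ha ⊢
        have h1 := h.apply_mul a a⁻¹
        rw [mul_inv_cancel, (h.apply_eq_zero (map_one σ)).1, ha] at h1
        have h2 : (α a : k) * ((α a)⁻¹ : kˣ) = 1 := Units.mul_inv _
        have h3 : (β a : k) * ((β a)⁻¹ : kˣ) = 1 := Units.mul_inv _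
        rw [map_inv, map_inv]
        rw [map_inv] at h1
        have h4 : (α a : k) ≠ 0 := (α a).ne_zero
        apply mul_left_cancel₀ h4
        linear_combination -h1 - t * h2 + t * h3 }
  have hS : S = ⊤ := by
    refine hgen S ?_ (fun τ hτ ↦ ?_) fun u hu ↦ ?_
    · exact (div_mul_cancel₀ _ (sub_ne_zero.mpr hφ)).symm
    · change ν τ = t * ((α τ : k) - β τ)
      -- Since `α = β` on `I`, coboundaries vanish there, so `s` and `t` need not agree.
      rw [hs τ hτ, hI τ hτ, sub_self, mul_zero, mul_zero]
    · obtain ⟨h1, h2, h3⟩ := h.apply_eq_zero hu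
      change ν u = t * ((α u : k) - β u)
      rw [h1, h2, h3, sub_self, mul_zero]
  exact ⟨t, fun g _ ↦ (hS ▸ Subgroup.mem_top g : g ∈ S)⟩

/-- A representation with the characteristic polynomials of `α ⊕ β`, where `α β⁻¹` is trivial on
`I` and has the value `q` at `φ`, is an extension of `β` by `α`: by the tame relation and `q ^ 2 ≠ 1`
every extension of `α` by `β` splits. -/
theorem exists_hasForm_of_tame {σ : Γ →* GL (Fin 2) k} {α β : Γ →* kˣ}
    (hσ : ∀ g, (σ g).val.charpoly = (Polynomial.X - Polynomial.C (α g : k)) *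
      (Polynomial.X - Polynomial.C (β g : k))) {φ : Γ} {I : Subgroup Γ} [I.Normal] {q : k}
    (hgen : ∀ S : Subgroup Γ, φ ∈ S → I ≤ S → σ.ker ≤ S → S = ⊤)
    (hI : ∀ τ ∈ I, α τ = β τ) (hφ : (α φ : k) = q * β φ) (hq : q ^ 2 ≠ 1)
    (htame : ∀ f : Γ → k, (∀ a ∈ I, ∀ b ∈ I, f (a * b) = f a + f b) →
      (∀ u ∈ I, u ∈ σ.ker → f u = 0) → ∀ τ ∈ I, f (φ * τ * φ⁻¹) = q * f τ) :
    ∃ ν : Γ → k, HasForm σ α β ν := by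
  have hne : (α φ : k) ≠ β φ := fun h ↦ hq <| by
    have : q = 1 := mul_right_cancel₀ (β φ).ne_zero (by rw [← hφ, h, one_mul])
    rw [this, one_pow]
  obtain ⟨ν, hνφ, h | h⟩ := exists_hasForm_or_of_charpoly hσ hne
  · exact ⟨ν, h⟩
  have hνI : ∀ τ ∈ I, ν τ = 0 := by
    have hα (g : Γ) : (α g : k) ≠ 0 := (α g).ne_zero
    -- Since `ν φ = 0`, direct computation multiplies `ν / α` by `β φ / α φ = q⁻¹` under conjugation
    -- by `φ`; the tame relation gives `q`.
    have hf := htame (fun g ↦ ν g / α g)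
      (fun a ha b hb ↦ by
        have := hα a
        have := hα b
        simp only [h.apply_mul, map_mul, Units.val_mul, ← hI a ha]
        field_simp
        ring)
      (fun u _ hu ↦ by simp [(h.apply_eq_zero hu).1])
    intro τ hτ
    have h1 := hf τ hτ
    have h2 : ν φ⁻¹ = 0 := by
      have := h.apply_mul φ φ⁻¹
      rw [mul_inv_cancel, (h.apply_eq_zero (map_one σ)).1, hνφ, zero_mul, add_zero] at this
      exact (mul_eq_zero.mp this.symm).resolve_left (β φ).ne_zero
    simp only [h.apply_mul, h2, hνφ, map_mul, map_inv, Units.val_mul, hφ,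
      Units.val_inv_eq_inv_val] at h1
    have h3 := hα τ
    have h4 : (β φ : k) ≠ 0 := (β φ).ne_zero
    have h5 : q ≠ 0 := fun h0 ↦ hα φ (by rw [hφ, h0, zero_mul])
    field_simp at h1
    have h6 : β φ * ((q ^ 2 - 1) * ν τ) = 0 := by linear_combination -h1
    exact (mul_eq_zero.mp ((mul_eq_zero.mp h6).resolve_left h4)).resolve_left (sub_ne_zero.mpr hq)
  obtain ⟨t, ht⟩ := h.splitsOn_top hgen (fun τ hτ ↦ (hI τ hτ).symm) hne.symm
    ⟨0, fun τ hτ ↦ by rw [hνI τ hτ, zero_mul]⟩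
  -- The eigenbasis normalization `ν φ = 0` makes the coboundary itself zero, so swapping the basis
  -- vectors suffices.
  have ht0 : t = 0 := by
    have := ht φ (Subgroup.mem_top φ)
    rw [hνφ] at this
    exact (mul_eq_zero.mp this.symm).resolve_right (sub_ne_zero.mpr hne.symm)
  exact ⟨ν, h.swap fun g ↦ by rw [ht g (Subgroup.mem_top g), ht0, zero_mul]⟩

end Representations
end SpecialReduction

namespace SpecialReduction

/-! ### Integrality and reduction of characters. -/

section Coefficients

variable {K : Type*} [Field K] [NumberField K] {l : HeightOneSpectrum (𝓞 K)}

theorem algebraMap_mem_maximalIdeal_iff (x : 𝓞 K) :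
    algebraMap (𝓞 K) (Integers l) x ∈ IsLocalRing.maximalIdeal (Integers l) ↔ x ∈ l.asIdeal := by
  rw [← HeightOneSpectrum.valuation_lt_one_iff_mem (K := K),
    ← HeightOneSpectrum.valuedAdicCompletion_eq_valuation']
  exact Valuation.mem_maximalIdeal_iff (v := (Valued.v : Valuation (Compl l) _))

theorem residueBar_algebraMap_eq_zero_iff (x : 𝓞 K) :
    algebraMap (Residue l) (ResidueBar l) (IsLocalRing.residue (Integers l)
      (algebraMap (𝓞 K) (Integers l) x)) = 0 ↔ x ∈ l.asIdeal := by
  rw [map_eq_zero, IsLocalRing.residue_eq_zero_iff, algebraMap_mem_maximalIdeal_iff]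

theorem charP_residueBar {ℓ : ℕ} [Fact ℓ.Prime] (hℓ : (ℓ : 𝓞 K) ∈ l.asIdeal) :
    CharP (ResidueBar l) ℓ :=
  (CharP.charP_iff_prime_eq_zero Fact.out).mpr <| by
    simpa only [map_natCast] using (residueBar_algebraMap_eq_zero_iff (ℓ : 𝓞 K)).mpr hℓ

theorem natCast_residueBar_sq_ne_one {q : ℕ} (hq : (q : 𝓞 K) ^ 2 - 1 ∉ l.asIdeal) :
    (q : ResidueBar l) ^ 2 ≠ 1 := fun h ↦ hq <| by
  rw [← residueBar_algebraMap_eq_zero_iff]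
  simp only [map_sub, map_pow, map_natCast, map_one, h, sub_self]

variable {G : Type*} [Group G]

open Polynomial in
theorem charpoly_eq_of_isIntegralModel {ρ : G →* GL (Fin 2) (Compl l)}
    {ρ₀ : G →* GL (Fin 2) (Integers l)} (hρ₀ : IsIntegralModel ρ ρ₀) {H : Subgroup G}
    {α β : H →* (ComplBar l)ˣ} {b : H → ComplBar l}
    (h : HasForm ((Matrix.GeneralLinearGroup.map (algebraMap (Compl l) (ComplBar l))).comp
      (ρ.comp H.subtype)) α β b) (g : H) :
    (ρ₀ g).val.charpoly.map (algebraMap (Integers l) (ComplBar l)) =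
      (X - C (α g : ComplBar l)) * (X - C (β g : ComplBar l)) := by
  obtain ⟨Q, hQ⟩ := hρ₀
  obtain ⟨P, hP⟩ := h
  have h1 : (ρ₀ g).val.charpoly.map (algebraMap (Integers l) (Compl l)) = (ρ g).val.charpoly := by
    rw [← Matrix.charpoly_map]
    have h := congrArg (fun M ↦ M.val.charpoly) (hQ g)
    refine h.trans ?_
    simp only [Units.val_mul, Matrix.coe_units_inv]
    exact Matrix.charpoly_units_conj Q (ρ g).val
  have h2 := congrArg Matrix.charpoly (hP g)
  rw [Units.val_mul, Units.val_mul, Matrix.coe_units_inv, Matrix.charpoly_units_conj] at h2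
  have h3 : (ρ g).val.charpoly.map (algebraMap (Compl l) (ComplBar l)) =
      (X - C (α g : ComplBar l)) * (X - C (β g : ComplBar l)) := by
    rw [← Matrix.charpoly_map]
    refine h2.trans ?_
    rw [Matrix.charpoly_fin_two]
    simp [Matrix.trace_fin_two, Matrix.det_fin_two]
    ring
  rw [IsScalarTower.algebraMap_eq (Integers l) (Compl l) (ComplBar l), ← Polynomial.map_map, h1, h3]

/-- A character occurring in a representation with an integral model has integral values. -/
theorem exists_integral_character {H : Type*} [Group H] {β : H →* (ComplBar l)ˣ}
    (p : H → Polynomial (Integers l)) (hp : ∀ g, (p g).Monic)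
    (hroot : ∀ g, (p g).eval₂ (algebraMap (Integers l) (ComplBar l)) (β g) = 0) :
    ∃ β₀ : H →* (IntegersBar l)ˣ, ∀ g, ((β₀ g : IntegersBar l) : ComplBar l) = β g := by
  let f : H →* IntegersBar l :=
    { toFun := fun g ↦ ⟨β g, p g, hp g, hroot g⟩
      map_one' := Subtype.ext (by simp)
      map_mul' := fun a b ↦ Subtype.ext (by simp) }
  exact ⟨f.toHomUnits, fun g ↦ rfl⟩

end Coefficients

end SpecialReduction

/-! ### Application to the residual representation. -/

open SpecialReduction in
theorem lemma3p3 {F K : Type*} [Field F] [NumberField F] [Field K] [NumberField K]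
    -- a finite place `v` of `F`, and a decomposition group at `v` given by a prime `w` over `v`
    (v : HeightOneSpectrum (𝓞 F)) (w : Ideal (𝓞 (AlgebraicClosure F))) [w.IsPrime]
    (hw : w.comap (algebraMap (𝓞 F) (𝓞 (AlgebraicClosure F))) = v.asIdeal)
    -- a prime `l` of `K` over `ℓ`, where `v` does not divide `ℓ`
    (l : HeightOneSpectrum (𝓞 K)) (ℓ : ℕ) [Fact ℓ.Prime]
    (hℓ : (ℓ : 𝓞 K) ∈ l.asIdeal) (hvℓ : (ℓ : 𝓞 F) ∉ v.asIdeal)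
    (hq : (Nat.card (𝓞 F ⧸ v.asIdeal) : 𝓞 K) ^ 2 - 1 ∉ l.asIdeal)
    -- the (unique) ring homomorphism from the `ℓ`-adic integers to the integers of `K_l`
    (j : ℤ_[ℓ] →+* Integers l)
    (ρ : AbsGal F →* GL (Fin 2) (Compl l)) (hρ : Continuous ρ)
    (ρbar : AbsGal F →* GL (Fin 2) (Residue l)) (hρbar : IsResidual ρ ρbar)
    -- over the algebraic closure of `K_l`, the restriction of `ρ` to `G_v` is a nonsplit extension
    -- of `χ` by `ε χ`
    (χ : decompositionGroup w →* (ComplBar l)ˣ)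
    (hχ : ∃ b : decompositionGroup w → ComplBar l,
      let εχ := ((Units.map ((algebraMap (Integers l) (ComplBar l)).comp j).toMonoidHom).comp
        ((cyclotomic F ℓ).comp (decompositionGroup w).subtype)) * χ
      HasForm ((Matrix.GeneralLinearGroup.map (algebraMap (Compl l) (ComplBar l))).comp
        (ρ.comp (decompositionGroup w).subtype)) εχ χ b ∧ ¬ SplitsOn ⊤ εχ χ b)
    (red : IntegersBar l →+* ResidueBar l) (hred : IsReductionMap l red) :
    -- `χ` has integral values, hence a reduction `χbar`
    ∃ χ₀ : decompositionGroup w →* (IntegersBar l)ˣ,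
      (∀ g, ((χ₀ g : IntegersBar l) : ComplBar l) = χ g) ∧
      let χbar : decompositionGroup w →* (ResidueBar l)ˣ := (Units.map red.toMonoidHom).comp χ₀
      let εbar : decompositionGroup w →* (ResidueBar l)ˣ :=
        (Units.map ((algebraMap (Residue l) (ResidueBar l)).comp
          ((IsLocalRing.residue (Integers l)).comp j)).toMonoidHom).comp
          ((cyclotomic F ℓ).comp (decompositionGroup w).subtype)
      let ρbar_v : decompositionGroup w →* GL (Fin 2) (ResidueBar l) :=
        (Matrix.GeneralLinearGroup.map (algebraMap (Residue l) (ResidueBar l))).comp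
          (ρbar.comp (decompositionGroup w).subtype)
      (∃ ν : decompositionGroup w → ResidueBar l, HasForm ρbar_v (εbar * χbar) χbar ν) ∧
      -- in every such form, the class of `ν` is ramified unless it vanishes
      ∀ ν : decompositionGroup w → ResidueBar l, HasForm ρbar_v (εbar * χbar) χbar ν →
        ¬ SplitsOn ⊤ (εbar * χbar) χbar ν →
        ¬ SplitsOn (inertiaGroup w) (εbar * χbar) χbar ν := by
  obtain ⟨b, hform, -⟩ := hχ
  obtain ⟨hopen, ρ₀, hρ₀, hchar⟩ := hρbar
  have hcharpoly := charpoly_eq_of_isIntegralModel hρ₀ hform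
  obtain ⟨χ₀, hχ₀⟩ := exists_integral_character (β := χ) (fun g ↦ (ρ₀ g).val.charpoly)
    (fun g ↦ Matrix.charpoly_monic _) fun g ↦ by
      rw [← Polynomial.eval_map, hcharpoly g]
      simp
  refine ⟨χ₀, hχ₀, ?_⟩
  intro χbar εbar ρbar_v
  have hunder : w.under (𝓞 F) = v.asIdeal := hw
  have hne : w.under (𝓞 F) ≠ ⊥ := hunder ▸ v.ne_bot
  have hℓv : (ℓ : 𝓞 F) ∉ w.under (𝓞 F) := hunder ▸ hvℓ
  have hℓw : (ℓ : 𝓞 (AlgebraicClosure F)) ∉ w := fun h ↦ hℓv (by simpa [Ideal.mem_comap] using h)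
  have := charP_residueBar hℓ
  have hchar_v (g : decompositionGroup w) : (ρbar_v g).val.charpoly =
      (Polynomial.X - Polynomial.C (((εbar * χbar) g : (ResidueBar l)ˣ) : ResidueBar l)) *
        (Polynomial.X - Polynomial.C ((χbar g : (ResidueBar l)ˣ) : ResidueBar l)) := by
    -- The factorization must hold over the integers of the algebraic closure before `red` applies;
    -- it is checked after embedding in the field.
    have h1 : (ρ₀ g).val.charpoly.map (algebraMap (Integers l) (IntegersBar l)) =
        (Polynomial.X - Polynomial.C (algebraMap (Integers l) (IntegersBar l)
          (j (cyclotomic F ℓ g)) * χ₀ g)) *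
        (Polynomial.X - Polynomial.C (χ₀ g : IntegersBar l)) := by
      apply Polynomial.map_injective (algebraMap (IntegersBar l) (ComplBar l))
        Subtype.val_injective
      rw [Polynomial.map_map, ← IsScalarTower.algebraMap_eq, hcharpoly g]
      simp only [Polynomial.map_mul, Polynomial.map_sub, Polynomial.map_X, Polynomial.map_C,
        map_mul, ← IsScalarTower.algebraMap_apply]
      have h2 : algebraMap (IntegersBar l) (ComplBar l) (χ₀ g) = χ g := hχ₀ g
      rw [h2, MonoidHom.mul_apply, Units.val_mul, map_mul]
      rfl
    have h2 := congrArg (Polynomial.map red) h1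
    have hred' : red.comp (algebraMap (Integers l) (IntegersBar l)) =
        (algebraMap (Residue l) (ResidueBar l)).comp (IsLocalRing.residue (Integers l)) :=
      RingHom.ext hred
    rw [Polynomial.map_map, hred', ← Polynomial.map_map, ← Matrix.charpoly_map] at h2
    have h3 : (ρbar_v g).val.charpoly =
        (ρbar g).val.charpoly.map (algebraMap (Residue l) (ResidueBar l)) :=
      Matrix.charpoly_map (ρbar g).val _
    rw [h3, hchar]
    refine h2.trans ?_
    simp only [Polynomial.map_mul, Polynomial.map_sub, Polynomial.map_X, Polynomial.map_C,
      map_mul, hred _, MonoidHom.mul_apply, Units.val_mul]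
    rfl
  -- Continuity of `ρbar` supplies the finite normal level `E` at which ramification theory is
  -- applied.
  obtain ⟨E, hE, hEn, hEker⟩ :=
    (krullTopology_mem_nhds_one_iff_of_normal F (AlgebraicClosure F) _).mp
      (hopen.mem_nhds (one_mem ρbar.ker))
  have hker (u : decompositionGroup w) (hu : (u : AbsGal F) ∈ E.fixingSubgroup) :
      u ∈ ρbar_v.ker := by
    have h : ρbar u = 1 := hEker hu
    simp [ρbar_v, MonoidHom.mem_ker, h]
  obtain ⟨φ', hφ'⟩ := exists_isArithFrobAt w hne
  let φ : decompositionGroup w := ⟨φ', hφ'.mem_stabilizer⟩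
  have hφ : IsArithFrobAt (𝓞 F) (φ : AbsGal F) w := hφ'
  let q := Nat.card (𝓞 F ⧸ w.under (𝓞 F))
  have hq2 : (q : ResidueBar l) ^ 2 ≠ 1 :=
    natCast_residueBar_sq_ne_one (by simpa only [q, hunder] using hq)
  let ψ : ℤ_[ℓ] →+* ResidueBar l := (algebraMap (Residue l) (ResidueBar l)).comp
    ((IsLocalRing.residue (Integers l)).comp j)
  have hεφ : (εbar φ : ResidueBar l) = q := map_cyclotomic_eq_natCast hℓw hφ ψ
  have hεI (τ : decompositionGroup w) (hτ : τ ∈ inertiaGroup w) : εbar τ = 1 := Units.ext <| by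
    exact (map_cyclotomic_eq_natCast (n := 1) hℓw (fun x ↦ by rw [pow_one]; exact hτ x) ψ).trans
      Nat.cast_one
  have hgen (S : Subgroup (decompositionGroup w)) (h1 : φ ∈ S) (h2 : inertiaGroup w ≤ S)
      (h3 : ρbar_v.ker ≤ S) : S = ⊤ :=
    eq_top_of_frobenius_mem_of_inertia_le E hne hφ h1 h2 fun u hu ↦ h3 (hker u hu)
  have hI (τ : decompositionGroup w) (hτ : τ ∈ inertiaGroup w) :
      (εbar * χbar) τ = χbar τ := by
    rw [MonoidHom.mul_apply, hεI τ hτ, one_mul]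
  have hφ_eq : ((εbar * χbar) φ : ResidueBar l) = q * χbar φ := by
    rw [MonoidHom.mul_apply, Units.val_mul, hεφ]
  refine ⟨exists_hasForm_of_tame hchar_v hgen hI hφ_eq hq2 fun f hf hfker τ hτ ↦
    map_conj_frobenius_eq E hne hφ hℓv hf (fun u hu huE ↦ hfker u hu (hker u huE)) hτ, ?_⟩
  intro ν hν hns hs
  refine hns (hν.splitsOn_top hgen hI (fun h ↦ hq2 ?_) hs)
  have : (q : ResidueBar l) = 1 :=
    mul_right_cancel₀ (χbar φ).ne_zero (by rw [← hφ_eq, h, one_mul])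
  rw [this, one_pow]
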